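/- A $3$-uniform hypergraph with vertex set $[n]=\{1,\dots,n\}$ is called a core if it has no isolated vertices and every edge contains at least two distinct vertices of degree at least $2$ (so vertices of degree $1$ are allowed). Put $f_k(\lambda)=e^\lambda-\sum_{i=0}^{k-1}\lambda^i/i!$ and $g_k(\lambda)=e^\lambda+k$. For integers $n\ge 1$ and $m>n/2$ write $\hat m=m/n$, let $\hat J_m=[\max\{0,2-3\hat m\},\,\min\{1,\hat m\}]$ and $h(y)=y\ln(yn)-y$ (with $0\ln 0=0$). For $x\in\hat J_m$ with $x\ne 1$ let $\hat n_2=1-x$, $\hat m_3=\hat m-x$, $\hat Q_2=3\hat m-x$, and, if $x\neq 2-3\hat m$, let $\lambda_x$ be the unique positive solution of $\lambda f_1(\lambda)/f_2(\lambda)=\hat Q_2/\hat n_2$. Define $$f_{\rm core}(x)=h(\hat Q_2)-h(\hat n_2)-h(x)-h(\hat m_3)-x\ln 2-\hat m_3\ln 6+\hat n_2\ln f_2(\lambda_x)-\hat Q_2\ln\lambda_x ,$$ where for $x=2-3\hat m$ the last two terms are replaced by their limit $-\hat n_2\ln 2$. Theorem. There is an absolute constant $\alpha>0$ such that the following holds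 for all integers $n\ge1$ and $m>n/2$ (in particular along every sequence $m=m(n)=n/2+R$ with $R\to\infty$, whenever $R>0$). The equation $$\frac{\lambda f_1(\lambda)g_2(\lambda)}{f_2(2\lambda)}=\frac{3m}{n}$$ has a unique positive solution $\lambda^*$, and with $\hat n_1^*=3m/(n\,g_2(\lambda^*))$ the number of cores with vertex set $[n]$ and $m$ edges is at most $$\alpha\, n\sqrt m\cdot n!\,\exp\bigl(n f_{\rm core}(\hat n_1^*)\bigr).$$ Moreover, $f_{\rm core}$ is continuous and strictly concave on $\hat J_m\setminus\{1\}$, it tends to $-\infty$ as $x\to1^-$ if $1\in\hat J_m$, and $\hat n_1^*\in \hat J_m\setminus\{1\}$ is its unique maximiser. -/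

import Mathlib

open Set Filter Topology
open scoped Nat

/-- The truncated exponential `f_k(x) = exp x - ∑_{i<k} x^i / i!`. -/
noncomputable def truncExp (k : ℕ) (x : ℝ) : ℝ :=
  Real.exp x - ∑ i ∈ Finset.range k, x ^ i / (i ! : ℝ)

/-- The function `g_k(x) = exp x + k`. -/
noncomputable def shiftExp (k : ℕ) (x : ℝ) : ℝ :=
  Real.exp x + (k : ℝ)

/-- The degree of the vertex `v` in the hypergraph with edge set `E`. -/
def hyperDegree {V : Type*} [DecidableEq V] (E : Finset (Finset V)) (v : V) : ℕ :=
  (E.filter (fun e => v ∈ e)).card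

/-- The 3-uniform hypergraph with vertex set `V` and edge set `E` is a core: every edge contains
at least two distinct vertices of degree at least `2`, and no vertex is isolated.
(Vertices of degree `1` are allowed.) -/
structure IsHyperCore {V : Type*} [DecidableEq V] (E : Finset (Finset V)) : Prop where
  uniform : ∀ e ∈ E, e.card = 3
  two_le : ∀ e ∈ E, 2 ≤ (e.filter (fun v => 2 ≤ hyperDegree E v)).card
  not_isolated : ∀ v : V, 1 ≤ hyperDegree E v

/-- The number of cores with vertex set `[n]` and `m` edges. -/
noncomputable def numCores (n m : ℕ) : ℕ :=
  {E : Finset (Finset (Fin n)) | IsHyperCore E ∧ E.card = m}.ncard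

open Classical in
/-- The positive solution `l` of `l f₁(l) / f₂(l) = c`; it exists and is unique for `c > 2`.
The value is `0` if there is no such solution, in particular for `c = 2`. -/
noncomputable def truncLambda (c : ℝ) : ℝ :=
  if h : ∃ l : ℝ, 0 < l ∧ l * truncExp 1 l / truncExp 2 l = c then h.choose else 0

/-- `h(y) = y ln(y n) - y`, with `0 ln 0 = 0`. -/
noncomputable def hCore (n : ℕ) (y : ℝ) : ℝ :=
  y * Real.log (y * n) - y

/-- The interval of all `x` with `max {0, 2 - 3m/n} ≤ x ≤ min {1, m/n}`. -/
noncomputable def coreInterval (n m : ℕ) : Set ℝ :=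
  Icc (max 0 (2 - 3 * ((m : ℝ) / n))) (min 1 ((m : ℝ) / n))

/-- The last two summands of the core function,
`n₂ ln f₂(λ) - Q₂ ln λ` with `n₂ = 1 - x`, `Q₂ = 3m/n - x` and `λ f₁(λ) / f₂(λ) = Q₂ / n₂`.
At the point `x = 2 - 3m/n`, where `Q₂ = 2 n₂` and `λ = 0`, it is replaced by its limit
`- n₂ ln 2`. -/
noncomputable def lambdaPart (n m : ℕ) (x : ℝ) : ℝ :=
  if x = 2 - 3 * ((m : ℝ) / n) then - ((1 - x) * Real.log 2)
  else
    (1 - x) * Real.log (truncExp 2 (truncLambda ((3 * ((m : ℝ) / n) - x) / (1 - x))))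
      - (3 * ((m : ℝ) / n) - x) * Real.log (truncLambda ((3 * ((m : ℝ) / n) - x) / (1 - x)))

/-- The core function on `coreInterval n m` without the point `1`. Here `x` is the proportion of
vertices of degree `1`; the scaled parameters are `Q₂ = 3m/n - x`, `n₂ = 1 - x`, `m₃ = m/n - x`.
(If `m ≥ n` then the limit at `x = 1` is `-∞`.) -/
noncomputable def fCore (n m : ℕ) (x : ℝ) : ℝ :=
  hCore n (3 * ((m : ℝ) / n) - x) - hCore n (1 - x) - hCore n x - hCore n ((m : ℝ) / n - x)
    - x * Real.log 2 - ((m : ℝ) / n - x) * Real.log 6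
    + lambdaPart n m x

/-- The point `3m / (n g₂(l))`. -/
noncomputable def corePoint (n m : ℕ) (l : ℝ) : ℝ :=
  3 * (m : ℝ) / (n * shiftExp 2 l)

/-! The bound fixes the set `A` of vertices of degree `1`, with `a = |A|`. An edge holds at most one
of them, so `a` edges meet `A` and `k = m - a` do not. Writing the other `Q = 2a + 3k` incidences as
a word over the complement of `A`, each letter occurs at least twice. There are `Q! [z^Q]
f₂(z)^(n-a)` such words, at most `Q! f₂(l)^(n-a) / l^Q` for every `l > 0`, and each core comes from
at least `2^a k! 6^k` of them (`card_coreClass_mul_le`, `card_wideWords_mul_le`). Optimising over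
`l` and applying Stirling's formula gives `exp (n f_core(a/n))` times `a! (n-a)!` and a factor of
order `√m`. Summing over `A` turns `a! (n-a)!` into `(n+1) n!`.

The analysis rests on duality: `lambdaPart` is the infimum over `l > 0` of `lambdaDual`, which is
affine in `x`. This follows from the tangent inequality `log_truncExp_two_tangent` and makes
`lambdaPart` concave; the entropy terms are strictly concave. Fixing `l = λ*` gives a concave
majorant of `f_core` that touches it at `n̂₁*` with derivative zero (`hasDerivAt_majorant`), so
`n̂₁*` is a maximiser and `λ_x` is never differentiated. Strict concavity makes the maximiser
unique, and uniqueness of `λ*` follows from that. -/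

/-! ### Truncated exponentials and existence of the parameters. -/

lemma truncExp_one (x : ℝ) : truncExp 1 x = Real.exp x - 1 := by
  simp [truncExp]

lemma truncExp_two (x : ℝ) : truncExp 2 x = Real.exp x - 1 - x := by
  simp [truncExp, Finset.sum_range_succ]; ring

lemma shiftExp_two (x : ℝ) : shiftExp 2 x = Real.exp x + 2 := by
  simp [shiftExp]

lemma truncExp_one_pos {x : ℝ} (hx : 0 < x) : 0 < truncExp 1 x := by
  rw [truncExp_one]; linarith [Real.add_one_lt_exp hx.ne']

lemma half_sq_le_truncExp_two {x : ℝ} (hx : 0 ≤ x) : x ^ 2 / 2 ≤ truncExp 2 x := by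
  rw [truncExp_two]; linarith [Real.quadratic_le_exp_of_nonneg hx]

lemma truncExp_two_pos {x : ℝ} (hx : 0 < x) : 0 < truncExp 2 x :=
  lt_of_lt_of_le (by positivity) (half_sq_le_truncExp_two hx.le)

lemma continuous_truncExp (k : ℕ) : Continuous (truncExp k) := by
  unfold truncExp; fun_prop

lemma continuous_shiftExp (k : ℕ) : Continuous (shiftExp k) := by
  unfold shiftExp; fun_prop

lemma hasSum_truncExp_two (x : ℝ) :
    HasSum (fun k : ℕ => x ^ (k + 2) / ((k + 2)! : ℝ)) (truncExp 2 x) := by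
  have h : HasSum (fun k : ℕ => x ^ k / (k ! : ℝ)) (Real.exp x) := by
    rw [Real.exp_eq_exp_ℝ]; exact NormedSpace.expSeries_div_hasSum_exp x
  exact (hasSum_nat_add_iff' 2).2 h

/-- Each term of the series of `f₂` is weighted by its exponent, so `x f₁(x) / f₂(x)` is the mean of
the Poisson distribution truncated to values at least `2`. -/
lemma hasSum_mul_truncExp_one (x : ℝ) :
    HasSum (fun k : ℕ => ((k : ℝ) + 2) * (x ^ (k + 2) / ((k + 2)! : ℝ))) (x * truncExp 1 x) := by
  have h : HasSum (fun k : ℕ => x ^ k / (k ! : ℝ)) (Real.exp x) := by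
    rw [Real.exp_eq_exp_ℝ]; exact NormedSpace.expSeries_div_hasSum_exp x
  have h1 : HasSum (fun k : ℕ => x ^ (k + 1) / ((k + 1)! : ℝ)) (truncExp 1 x) :=
    (hasSum_nat_add_iff' 1).2 h
  convert! h1.mul_left x using 2 with k
  have : ((k + 1)! : ℝ) ≠ 0 := by positivity
  have h2 : ((k : ℝ) + 2) ≠ 0 := by positivity
  rw [Nat.factorial_succ (k + 1)]
  push_cast
  field_simp
  ring

/-- Upper bound for the truncated exponential near `0`. -/
lemma truncExp_two_le {x : ℝ} (hx : 0 ≤ x) : truncExp 2 x ≤ x ^ 2 / 2 * Real.exp x := by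
  have h : HasSum (fun k : ℕ => x ^ k / (k ! : ℝ)) (Real.exp x) := by
    rw [Real.exp_eq_exp_ℝ]; exact NormedSpace.expSeries_div_hasSum_exp x
  refine hasSum_le (fun k => ?_) (hasSum_truncExp_two x) (h.mul_left (x ^ 2 / 2))
  have h1 : (2 : ℝ) * (k ! : ℝ) ≤ ((k + 2)! : ℝ) := by
    rw [Nat.factorial_succ (k + 1), Nat.factorial_succ k]
    push_cast
    have : (0 : ℝ) < (k ! : ℝ) := by positivity
    have hk : (0 : ℝ) ≤ k := by positivity
    nlinarith [mul_nonneg hk this.le, mul_nonneg (mul_nonneg hk hk) this.le]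
  have h2 : x ^ 2 / 2 * (x ^ k / (k ! : ℝ)) = x ^ (k + 2) / (2 * (k ! : ℝ)) := by
    rw [pow_add]; field_simp
  rw [h2]
  exact div_le_div_of_nonneg_left (by positivity) (by positivity) h1

/-- Jensen's inequality for the truncated Poisson distribution: in the variable `log l`, the
function `log (f₂ l)` lies above its tangents. -/
lemma log_truncExp_two_tangent {l u : ℝ} (hl : 0 < l) (hu : 0 < u) :
    l * truncExp 1 l / truncExp 2 l * (Real.log u - Real.log l) ≤
      Real.log (truncExp 2 u) - Real.log (truncExp 2 l) := by
  set a := l * truncExp 1 l / truncExp 2 l with ha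
  set t := Real.log u - Real.log l with ht
  have hl2 := truncExp_two_pos hl
  have hu2 := truncExp_two_pos hu
  have hul : u = l * Real.exp t := by
    rw [ht, Real.exp_sub, Real.exp_log hu, Real.exp_log hl]; field_simp
  have key : Real.exp (a * t) * truncExp 2 l ≤ truncExp 2 u := by
    -- Termwise, `exp ((k+2-a)t) ≥ 1 + (k+2-a)t`; the linear part sums to zero because `a` is the
    -- mean.
    have hs := (((hasSum_mul_truncExp_one l).sub ((hasSum_truncExp_two l).mul_left a)).mul_left
      (Real.exp (a * t) * t)).add ((hasSum_truncExp_two l).mul_left (Real.exp (a * t)))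
    have e : Real.exp (a * t) * t * (l * truncExp 1 l - a * truncExp 2 l)
        + Real.exp (a * t) * truncExp 2 l = Real.exp (a * t) * truncExp 2 l := by
      rw [ha]; field_simp; ring
    rw [e] at hs
    refine hasSum_le (fun k => ?_) hs (hasSum_truncExp_two u)
    have h1 : u ^ (k + 2) / ((k + 2)! : ℝ) =
        Real.exp (a * t) * Real.exp (((k : ℝ) + 2 - a) * t) * (l ^ (k + 2) / ((k + 2)! : ℝ)) := by
      rw [hul, mul_pow, ← Real.exp_nat_mul, ← Real.exp_add]
      have : ((k + 2 : ℕ) : ℝ) * t = a * t + ((k : ℝ) + 2 - a) * t := by push_cast; ring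
      rw [this]; ring
    rw [h1]
    have h2 : 1 + ((k : ℝ) + 2 - a) * t ≤ Real.exp (((k : ℝ) + 2 - a) * t) := by
      linarith [Real.add_one_le_exp (((k : ℝ) + 2 - a) * t)]
    have h3 : 0 ≤ Real.exp (a * t) * (l ^ (k + 2) / ((k + 2)! : ℝ)) := by positivity
    nlinarith [mul_le_mul_of_nonneg_left h2 h3]
  have := Real.log_le_log (by positivity) key
  rw [Real.log_mul (Real.exp_pos _).ne' hl2.ne', Real.log_exp] at this
  linarith

/-- The equation `l f₁(l) / f₂(l) = c` has a positive solution for `c > 2`. -/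
lemma exists_truncLambda {c : ℝ} (hc : 2 < c) :
    ∃ l : ℝ, 0 < l ∧ l * truncExp 1 l / truncExp 2 l = c := by
  -- The endpoints come from `l ≤ l f₁(l) / f₂(l) ≤ l + 2`; the upper bound amounts to `exp l ≥ 1 +
  -- l + l²/2`.
  have hcont : ContinuousOn (fun l : ℝ => l * truncExp 1 l / truncExp 2 l) (Icc (c - 2) c) := by
    refine ContinuousOn.div (by have := continuous_truncExp 1; fun_prop)
      (continuous_truncExp 2).continuousOn fun x hx => (truncExp_two_pos ?_).ne'
    linarith [hx.1]
  have h1 : (fun l : ℝ => l * truncExp 1 l / truncExp 2 l) (c - 2) ≤ c := by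
    have hp : 0 < c - 2 := by linarith
    rw [div_le_iff₀ (truncExp_two_pos hp)]
    have := Real.quadratic_le_exp_of_nonneg hp.le
    rw [truncExp_one, truncExp_two]
    nlinarith
  have h2 : c ≤ (fun l : ℝ => l * truncExp 1 l / truncExp 2 l) c := by
    have hp : 0 < c := by linarith
    rw [le_div_iff₀ (truncExp_two_pos hp), truncExp_one, truncExp_two]
    nlinarith
  obtain ⟨l, hl, h⟩ := intermediate_value_Icc (by linarith : c - 2 ≤ c) hcont ⟨h1, h2⟩
  exact ⟨l, by linarith [hl.1], h⟩

lemma truncLambda_spec {c : ℝ} (hc : 2 < c) :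
    0 < truncLambda c ∧
      truncLambda c * truncExp 1 (truncLambda c) / truncExp 2 (truncLambda c) = c := by
  have h := exists_truncLambda hc
  rw [truncLambda, dif_pos h]
  exact h.choose_spec

/-- The equation `l f₁(l) g₂(l) / f₂(2l) = c` has a positive solution for `c > 3/2`. -/
lemma exists_core_parameter {c : ℝ} (hc : 3 / 2 < c) :
    ∃ l : ℝ, 0 < l ∧ l * truncExp 1 l * shiftExp 2 l / truncExp 2 (2 * l) = c := by
  -- Near `0` the quotient is at most `exp a (exp a + 2) / 2`, which tends to `3/2`.
  obtain ⟨a, ha0, hac, ha⟩ : ∃ a : ℝ, 0 < a ∧ a < c ∧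
      a * truncExp 1 a * shiftExp 2 a / truncExp 2 (2 * a) ≤ c := by
    have hlim : Tendsto (fun a : ℝ => Real.exp a * (Real.exp a + 2) / 2) (𝓝[>] 0) (𝓝 (3 / 2)) := by
      have : Continuous (fun a : ℝ => Real.exp a * (Real.exp a + 2) / 2) := by fun_prop
      have h := (this.tendsto 0).mono_left (nhdsWithin_le_nhds (s := Ioi 0))
      convert h using 2
      norm_num
    obtain ⟨a, h1, h2⟩ := ((hlim.eventually_lt_const hc).and
      (Ioo_mem_nhdsGT (by linarith : (0 : ℝ) < c))).exists
    refine ⟨a, h2.1, h2.2, le_trans ?_ h1.le⟩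
    have h0 := h2.1
    rw [div_le_iff₀ (truncExp_two_pos (by linarith))]
    have h3 := half_sq_le_truncExp_two (x := 2 * a) (by linarith)
    have h4 : truncExp 1 a ≤ a * Real.exp a := by
      rw [truncExp_one]
      have := Real.add_one_le_exp (-a)
      have h5 : Real.exp a * Real.exp (-a) = 1 := by rw [← Real.exp_add]; simp
      nlinarith [Real.exp_pos a]
    rw [shiftExp_two]
    calc a * truncExp 1 a * (Real.exp a + 2) ≤ a * (a * Real.exp a) * (Real.exp a + 2) := by gcongr
      _ = Real.exp a * (Real.exp a + 2) / 2 * ((2 * a) ^ 2 / 2) := by ring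
      _ ≤ _ := by gcongr
  have hcont : ContinuousOn
      (fun l : ℝ => l * truncExp 1 l * shiftExp 2 l / truncExp 2 (2 * l)) (Icc a c) := by
    have h1 := continuous_truncExp 1
    have h2 := continuous_truncExp 2
    have h3 := continuous_shiftExp 2
    refine ContinuousOn.div (by fun_prop) (by fun_prop) fun x hx => (truncExp_two_pos ?_).ne'
    linarith [hx.1]
  have h2 : c ≤ (fun l : ℝ => l * truncExp 1 l * shiftExp 2 l / truncExp 2 (2 * l)) c := by
    have hp : 0 < c := by linarith
    have he : 2 ≤ Real.exp c := by linarith [Real.add_one_le_exp c]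
    have hsq : Real.exp (2 * c) = Real.exp c ^ 2 := by rw [← Real.exp_nat_mul]; norm_num
    rw [le_div_iff₀ (truncExp_two_pos (by linarith)), truncExp_one, truncExp_two, shiftExp_two, hsq,
      mul_assoc]
    gcongr
    nlinarith
  obtain ⟨l, hl, h⟩ := intermediate_value_Icc hac.le hcont ⟨ha, h2⟩
  exact ⟨l, by linarith [hl.1], h⟩

/-! ### The implicit term as an infimum of affine functions. -/

/-- The expression whose infimum over `l > 0` is `lambdaPart`; it is affine in `x`. -/
noncomputable def lambdaDual (c l x : ℝ) : ℝ :=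
  (1 - x) * Real.log (truncExp 2 l) - (3 * c - x) * Real.log l

/-- Tangent inequalities in both directions show that any two roots give the same value, so
uniqueness of the root is not needed. -/
lemma lambdaPart_eq_lambdaDual {n m : ℕ} {x l : ℝ} (hx : x < 1)
    (h2 : 2 - 3 * ((m : ℝ) / n) < x) (hl : 0 < l)
    (h : l * truncExp 1 l / truncExp 2 l = (3 * ((m : ℝ) / n) - x) / (1 - x)) :
    lambdaPart n m x = lambdaDual ((m : ℝ) / n) l x := by
  set c := (m : ℝ) / n
  have hx1 : 0 < 1 - x := by linarith
  have hc : 2 < (3 * c - x) / (1 - x) := by rw [lt_div_iff₀ hx1]; linarith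
  obtain ⟨hp, hs⟩ := truncLambda_spec hc
  rw [lambdaPart, if_neg h2.ne', lambdaDual]
  set u := truncLambda ((3 * c - x) / (1 - x))
  have e1 := log_truncExp_two_tangent hl hp
  have e2 := log_truncExp_two_tangent hp hl
  rw [h] at e1
  rw [hs] at e2
  have e3 := mul_le_mul_of_nonneg_left e1 hx1.le
  have e4 := mul_le_mul_of_nonneg_left e2 hx1.le
  rw [← mul_assoc, mul_div_cancel₀ _ hx1.ne'] at e3 e4
  linarith

/-- Multiplied by `1 - x`, the tangent at `λ_x` has slope `3m/n - x`. At the left endpoint the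
inequality is `f₂(l) ≥ l²/2`. -/
lemma lambdaPart_le_lambdaDual {n m : ℕ} {x l : ℝ} (hx : x < 1)
    (h2 : 2 - 3 * ((m : ℝ) / n) ≤ x) (hl : 0 < l) :
    lambdaPart n m x ≤ lambdaDual ((m : ℝ) / n) l x := by
  have hx1 : 0 < 1 - x := by linarith
  rcases h2.lt_or_eq with h2 | h2
  · have hc : 2 < (3 * ((m : ℝ) / n) - x) / (1 - x) := by rw [lt_div_iff₀ hx1]; linarith
    obtain ⟨hp, hs⟩ := truncLambda_spec hc
    rw [lambdaPart_eq_lambdaDual hx h2 hp hs]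
    have e1 := mul_le_mul_of_nonneg_left (log_truncExp_two_tangent hp hl) hx1.le
    rw [hs, ← mul_assoc, mul_div_cancel₀ _ hx1.ne'] at e1
    unfold lambdaDual
    linarith
  · rw [lambdaPart, if_pos h2.symm, lambdaDual]
    have e := Real.log_le_log (by positivity) (half_sq_le_truncExp_two hl.le)
    rw [Real.log_div (by positivity) (by norm_num), Real.log_pow] at e
    have e1 := mul_le_mul_of_nonneg_left e hx1.le
    have e2 : 3 * ((m : ℝ) / n) - x = 2 * (1 - x) := by linarith
    rw [e2]
    push_cast at e1
    linarith

/-- The slack `ε` is for the left endpoint, where the infimum is only approached as `l → 0`: there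
`f₂(l) ≤ (l²/2) exp l` costs `(1 - x) l`, which equals `ε` for the chosen `l`. -/
lemma exists_lambdaDual_le {n m : ℕ} {x ε : ℝ} (hx : x < 1)
    (h2 : 2 - 3 * ((m : ℝ) / n) ≤ x) (hε : 0 < ε) :
    ∃ l : ℝ, 0 < l ∧ lambdaDual ((m : ℝ) / n) l x ≤ lambdaPart n m x + ε := by
  have hx1 : 0 < 1 - x := by linarith
  rcases h2.lt_or_eq with h2 | h2
  · have hc : 2 < (3 * ((m : ℝ) / n) - x) / (1 - x) := by rw [lt_div_iff₀ hx1]; linarith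
    obtain ⟨hp, hs⟩ := truncLambda_spec hc
    exact ⟨_, hp, by rw [lambdaPart_eq_lambdaDual hx h2 hp hs]; linarith⟩
  · refine ⟨ε / (1 - x), by positivity, ?_⟩
    have hl : 0 < ε / (1 - x) := by positivity
    rw [lambdaPart, if_pos h2.symm, lambdaDual]
    set l := ε / (1 - x) with hl'
    have e := Real.log_le_log (truncExp_two_pos hl) (truncExp_two_le hl.le)
    rw [Real.log_mul (by positivity) (by positivity), Real.log_exp,
      Real.log_div (by positivity) (by norm_num), Real.log_pow] at e
    have e1 := mul_le_mul_of_nonneg_left e hx1.le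
    have e2 : 3 * ((m : ℝ) / n) - x = 2 * (1 - x) := by linarith
    have e3 : (1 - x) * l = ε := by rw [hl']; field_simp
    rw [e2]
    push_cast at e1
    linarith

lemma concaveOn_lambdaPart (n m : ℕ) :
    ConcaveOn ℝ (Ico (2 - 3 * ((m : ℝ) / n)) 1) (lambdaPart n m) := by
  refine ⟨convex_Ico _ _, fun x hx y hy a b ha hb hab => ?_⟩
  have hz := convex_Ico (2 - 3 * ((m : ℝ) / n)) 1 hx hy ha hb hab
  refine le_of_forall_pos_le_add fun ε hε => ?_
  obtain ⟨l, hl, h⟩ := exists_lambdaDual_le (n := n) (m := m) hz.2 hz.1 hε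
  refine le_trans ?_ h
  have h1 := mul_le_mul_of_nonneg_left (lambdaPart_le_lambdaDual (n := n) hx.2 hx.1 hl) ha
  have h2 := mul_le_mul_of_nonneg_left (lambdaPart_le_lambdaDual (n := n) hy.2 hy.1 hl) hb
  simp only [smul_eq_mul] at *
  refine (add_le_add h1 h2).trans_eq ?_
  simp only [lambdaDual]
  obtain rfl : b = 1 - a := by linarith
  ring

/-- Concavity leaves only the left endpoint to check; continuity there says that the special value
is indeed the limit. -/
lemma continuousOn_lambdaPart {n m : ℕ} (hc : 1 / 2 < (m : ℝ) / n) :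
    ContinuousOn (lambdaPart n m) (Ico (2 - 3 * ((m : ℝ) / n)) 1) := by
  have hcc := concaveOn_lambdaPart n m
  refine hcc.continuousOn_Ico ?_
  set a := 2 - 3 * ((m : ℝ) / n) with ha
  have ha1 : a < 1 := by rw [ha]; linarith
  rw [← continuousWithinAt_Ico_iff_Ici ha1]
  set b := (a + 1) / 2 with hb
  refine tendsto_order.2 ⟨fun y hy => ?_, fun y hy => ?_⟩
  · -- below: the chord between `a` and `b`
    have hcont : Continuous fun x : ℝ => (b - x) / (b - a) * lambdaPart n m a
        + (x - a) / (b - a) * lambdaPart n m b := by fun_prop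
    have hab : 0 < b - a := by rw [hb]; linarith
    have hlim := (hcont.tendsto a).mono_left (nhdsWithin_le_nhds (s := Ico a 1))
    have hev := hlim.eventually_const_lt (u := y) (by simpa [div_self hab.ne'] using hy)
    have hev2 : ∀ᶠ x in 𝓝[Ico a 1] a, x < b :=
      nhdsWithin_le_nhds (Iio_mem_nhds (by linarith))
    filter_upwards [hev, hev2, self_mem_nhdsWithin] with x hx hxb hxa
    refine hx.trans_le ?_
    have := hcc.2 (⟨le_rfl, ha1⟩ : a ∈ Ico a 1)
      (⟨by linarith, by rw [hb]; linarith⟩ : b ∈ Ico a 1)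
      (div_nonneg (by linarith : 0 ≤ b - x) hab.le)
      (div_nonneg (by linarith [hxa.1] : 0 ≤ x - a) hab.le) (by field_simp; ring)
    simp only [smul_eq_mul] at this
    convert this using 2
    field_simp
    ring
  · -- above: an affine majorant
    obtain ⟨l, hl, h⟩ := exists_lambdaDual_le (n := n) (m := m) (x := a) (ε := (y - lambdaPart n m a) / 2)
      ha1 le_rfl (by linarith)
    have hcont : Continuous fun x : ℝ => lambdaDual ((m : ℝ) / n) l x := by
      unfold lambdaDual; fun_prop
    have hlim := (hcont.tendsto a).mono_left (nhdsWithin_le_nhds (s := Ico a 1))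
    filter_upwards [hlim.eventually_lt_const (u := y) (by linarith), self_mem_nhdsWithin]
      with x hx hxa
    exact (lambdaPart_le_lambdaDual hxa.2 hxa.1 hl).trans_lt hx

/-! ### The entropy terms. -/

lemma hCore_eq {n : ℕ} (hn : 1 ≤ n) (y : ℝ) :
    hCore n y = y * Real.log y + (Real.log n - 1) * y := by
  have hn' : (n : ℝ) ≠ 0 := by positivity
  rcases eq_or_ne y 0 with rfl | hy
  · simp [hCore]
  · rw [hCore, Real.log_mul hy hn']; ring

lemma continuous_hCore {n : ℕ} (hn : 1 ≤ n) : Continuous (hCore n) := by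
  have : hCore n = fun y => y * Real.log y + (Real.log n - 1) * y := funext (hCore_eq hn)
  rw [this]
  exact Real.continuous_mul_log.add (by fun_prop)

lemma hasDerivAt_hCore {n : ℕ} (hn : 1 ≤ n) {y : ℝ} (hy : y ≠ 0) :
    HasDerivAt (hCore n) (Real.log y + Real.log n) y := by
  have : hCore n = fun y => y * Real.log y + (Real.log n - 1) * y := funext (hCore_eq hn)
  rw [this]
  convert! (Real.hasDerivAt_mul_log hy).add ((hasDerivAt_id y).const_mul (Real.log n - 1)) using 1
  ring

/-- The part of the core function that does not involve `lambdaPart`. -/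
noncomputable def coreEntropy (n : ℕ) (c x : ℝ) : ℝ :=
  hCore n (3 * c - x) - hCore n (1 - x) - hCore n x - hCore n (c - x)
    - x * Real.log 2 - (c - x) * Real.log 6

lemma fCore_eq (n m : ℕ) (x : ℝ) :
    fCore n m x = coreEntropy n ((m : ℝ) / n) x + lambdaPart n m x := rfl

lemma continuous_coreEntropy {n : ℕ} (hn : 1 ≤ n) (c : ℝ) : Continuous (coreEntropy n c) := by
  have := continuous_hCore hn
  unfold coreEntropy
  fun_prop

/-- The derivative `log ((u + d) / u)` decreases. With `u = c - x` and `d = 2c` this absorbs the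
convex summand `h(3c - x)` into `-h(c - x)`. -/
lemma concaveOn_mul_log_shift_sub {d : ℝ} (hd : 0 ≤ d) :
    ConcaveOn ℝ (Ici 0) fun u : ℝ => (u + d) * Real.log (u + d) - u * Real.log u := by
  have hder : ∀ u ∈ Ioi (0 : ℝ), HasDerivAt
      (fun u : ℝ => (u + d) * Real.log (u + d) - u * Real.log u)
      (Real.log (u + d) - Real.log u) u := by
    intro u hu
    have hu0 : (0 : ℝ) < u := hu
    convert! ((Real.hasDerivAt_mul_log (x := u + d) (by positivity)).comp_add_const u d).sub
      (Real.hasDerivAt_mul_log hu0.ne') using 1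
    ring
  have hc := Real.continuous_mul_log
  refine AntitoneOn.concaveOn_of_deriv (convex_Ici 0) ?_ ?_ ?_
  · exact ((hc.comp (continuous_add_const d)).sub hc).continuousOn
  · rw [interior_Ici]
    exact fun u hu => (hder u hu).differentiableAt.differentiableWithinAt
  · rw [interior_Ici]
    intro u hu v hv huv
    rw [(hder u hu).deriv, (hder v hv).deriv]
    have hu0 : (0 : ℝ) < u := hu
    have hv0 : (0 : ℝ) < v := hv
    rw [← Real.log_div (by positivity) (by positivity), ← Real.log_div (by positivity) (by positivity)]
    refine Real.log_le_log (by positivity) ?_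
    rw [div_le_div_iff₀ hv0 hu0]
    nlinarith

lemma strictConcaveOn_coreEntropy {n : ℕ} (hn : 1 ≤ n) {c : ℝ} (hc : 0 ≤ c) :
    StrictConcaveOn ℝ (Icc 0 (min 1 c)) (coreEntropy n c) := by
  refine ⟨convex_Icc _ _, fun x hx y hy hxy a b ha hb hab => ?_⟩
  have hx1 := hx.2.trans (min_le_left _ _)
  have hxc := hx.2.trans (min_le_right _ _)
  have hy1 := hy.2.trans (min_le_left _ _)
  have hyc := hy.2.trans (min_le_right _ _)
  have e1 := (concaveOn_mul_log_shift_sub (d := 2 * c) (by linarith)).2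
    (sub_nonneg.2 hxc : c - x ∈ Ici 0) (sub_nonneg.2 hyc : c - y ∈ Ici 0) ha.le hb.le hab
  -- Strictness comes from the summand `-x log x` alone.
  have e2 := Real.strictConvexOn_mul_log.2 (hx.1 : x ∈ Ici 0) (hy.1 : y ∈ Ici 0) hxy ha hb hab
  have e3 := Real.convexOn_mul_log.2 (sub_nonneg.2 hx1 : 1 - x ∈ Ici 0)
    (sub_nonneg.2 hy1 : 1 - y ∈ Ici 0) ha.le hb.le hab
  simp only [smul_eq_mul, coreEntropy, hCore_eq hn] at *
  obtain rfl : b = 1 - a := by linarith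
  have i1 : a * (c - x) + (1 - a) * (c - y) = c - (a * x + (1 - a) * y) := by ring
  have i2 : a * (1 - x) + (1 - a) * (1 - y) = 1 - (a * x + (1 - a) * y) := by ring
  have i3 : c - x + 2 * c = 3 * c - x := by ring
  have i4 : c - y + 2 * c = 3 * c - y := by ring
  have i5 : c - (a * x + (1 - a) * y) + 2 * c = 3 * c - (a * x + (1 - a) * y) := by ring
  rw [i1, i3, i4, i5] at e1
  rw [i2] at e3
  linarith

/-! ### Continuity, strict concavity and the limit at `1`. -/

lemma one_half_lt_div {n m : ℕ} (hn : 1 ≤ n) (hm : n < 2 * m) : 1 / 2 < (m : ℝ) / n := by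
  have hn' : (0 : ℝ) < n := by positivity
  rw [lt_div_iff₀ hn']
  have : (n : ℝ) < 2 * m := by exact_mod_cast hm
  linarith

lemma mem_coreInterval_diff {n m : ℕ} {x : ℝ} :
    x ∈ coreInterval n m \ {1} ↔
      (0 ≤ x ∧ 2 - 3 * ((m : ℝ) / n) ≤ x) ∧ x < 1 ∧ x ≤ (m : ℝ) / n := by
  simp only [coreInterval, Set.mem_sdiff, mem_Icc, max_le_iff, le_min_iff, mem_singleton_iff]
  constructor
  · rintro ⟨⟨h1, h2, h3⟩, h4⟩
    exact ⟨h1, lt_of_le_of_ne h2 h4, h3⟩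
  · rintro ⟨h1, h2, h3⟩
    exact ⟨⟨h1, h2.le, h3⟩, h2.ne⟩

lemma convex_coreInterval_diff (n m : ℕ) : Convex ℝ (coreInterval n m \ {1}) := by
  have : coreInterval n m \ {1} =
      (Ici 0 ∩ Ici (2 - 3 * ((m : ℝ) / n))) ∩ (Iio 1 ∩ Iic ((m : ℝ) / n)) := by
    ext x; exact mem_coreInterval_diff
  rw [this]
  exact ((convex_Ici _).inter (convex_Ici _)).inter ((convex_Iio _).inter (convex_Iic _))

lemma continuousOn_fCore {n m : ℕ} (hn : 1 ≤ n) (hm : n < 2 * m) :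
    ContinuousOn (fCore n m) (coreInterval n m \ {1}) := by
  refine ((continuous_coreEntropy hn _).continuousOn).add
    ((continuousOn_lambdaPart (one_half_lt_div hn hm)).mono fun x hx => ?_)
  rw [mem_coreInterval_diff] at hx
  exact ⟨hx.1.2, hx.2.1⟩

lemma strictConcaveOn_fCore {n m : ℕ} (hn : 1 ≤ n) :
    StrictConcaveOn ℝ (coreInterval n m \ {1}) (fCore n m) := by
  refine ((strictConcaveOn_coreEntropy hn (by positivity)).subset ?_
    (convex_coreInterval_diff n m)).add_concaveOn
    ((concaveOn_lambdaPart n m).subset ?_ (convex_coreInterval_diff n m))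
  · intro x hx
    rw [mem_coreInterval_diff] at hx
    exact ⟨hx.1.1, le_min hx.2.1.le hx.2.2⟩
  · intro x hx
    rw [mem_coreInterval_diff] at hx
    exact ⟨hx.1.2, hx.2.1⟩

lemma tendsto_fCore_atBot {n m : ℕ} (hn : 1 ≤ n) (h1 : 1 ∈ coreInterval n m) :
    Tendsto (fCore n m) (𝓝[<] 1) atBot := by
  have hc : 1 ≤ (m : ℝ) / n := h1.2.trans (min_le_right _ _)
  set c := (m : ℝ) / n with hcdef
  refine tendsto_atBot.2 fun b => ?_
  set G := coreEntropy n c 1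
  have hlim : ∀ l : ℝ, Tendsto (fun x => coreEntropy n c x + lambdaDual c l x) (𝓝[<] 1)
      (𝓝 (G - (3 * c - 1) * Real.log l)) := by
    intro l
    have hcont : Continuous (fun x => coreEntropy n c x + lambdaDual c l x) := by
      have := continuous_coreEntropy hn c
      unfold lambdaDual; fun_prop
    have := (hcont.tendsto 1).mono_left (nhdsWithin_le_nhds (s := Iio 1))
    convert this using 2
    simp only [lambdaDual, G]; ring
  -- This `l` makes the limit of the majorant at `1` equal to `b - 1`.
  have hl := hlim (Real.exp ((G - b + 1) / (3 * c - 1)))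
  rw [Real.log_exp, mul_div_cancel₀ _ (by linarith : 3 * c - 1 ≠ 0)] at hl
  filter_upwards [hl.eventually_lt_const (u := b) (by linarith),
    Ioo_mem_nhdsLT (by linarith : 2 - 3 * c < 1)] with x hx hx1
  rw [fCore_eq]
  have := lambdaPart_le_lambdaDual (n := n) (m := m) hx1.2 hx1.1.le
    (Real.exp_pos ((G - b + 1) / (3 * c - 1)))
  linarith

/-! ### The maximiser and uniqueness of the parameter. -/

section CorePoint

variable {n m : ℕ} {l : ℝ}

lemma corePoint_eq (n m : ℕ) (l : ℝ) :
    corePoint n m l = 3 * ((m : ℝ) / n) / (Real.exp l + 2) := by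
  rw [corePoint, shiftExp_two, ← mul_div_assoc, div_div]

lemma truncExp_two_two_mul (l : ℝ) : truncExp 2 (2 * l) = Real.exp l ^ 2 - 1 - 2 * l := by
  rw [truncExp_two, ← Real.exp_nat_mul]; norm_num

/-- All scaled parameters become products in `l`, so their logarithms split. The second formula
rests on `f₂(2l) = l f₁(l) + (exp l + 1) f₂(l)`. -/
lemma corePoint_spec (hl : 0 < l)
    (h : l * truncExp 1 l * shiftExp 2 l / truncExp 2 (2 * l) = 3 * (m : ℝ) / n) :
    corePoint n m l = l * truncExp 1 l / truncExp 2 (2 * l) ∧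
    1 - corePoint n m l = (Real.exp l + 1) * truncExp 2 l / truncExp 2 (2 * l) ∧
    3 * ((m : ℝ) / n) - corePoint n m l = l * truncExp 1 l * (Real.exp l + 1) / truncExp 2 (2 * l) ∧
    (m : ℝ) / n - corePoint n m l = corePoint n m l * truncExp 1 l / 3 := by
  have h2 := (truncExp_two_pos (by linarith : 0 < 2 * l)).ne'
  have hg : Real.exp l + 2 ≠ 0 := by positivity
  rw [mul_div_assoc 3] at h
  have h0 : corePoint n m l = l * truncExp 1 l / truncExp 2 (2 * l) := by
    rw [corePoint_eq, ← h, shiftExp_two]; field_simp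
  refine ⟨h0, ?_, ?_, ?_⟩
  · rw [h0, eq_div_iff h2, sub_mul, div_mul_cancel₀ _ h2, truncExp_two_two_mul, truncExp_one,
      truncExp_two]
    ring
  · rw [h0, ← h, shiftExp_two]; field_simp; ring
  · have : (m : ℝ) / n = l * truncExp 1 l * shiftExp 2 l / truncExp 2 (2 * l) / 3 := by
      rw [h]; ring
    rw [h0, this, shiftExp_two]
    field_simp
    rw [truncExp_one]; ring

lemma corePoint_bounds (hl : 0 < l)
    (h : l * truncExp 1 l * shiftExp 2 l / truncExp 2 (2 * l) = 3 * (m : ℝ) / n) :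
    0 < corePoint n m l ∧ corePoint n m l < 1 ∧ corePoint n m l < (m : ℝ) / n ∧
      2 - 3 * ((m : ℝ) / n) < corePoint n m l := by
  obtain ⟨e1, e2, e3, e4⟩ := corePoint_spec hl h
  have p1 := truncExp_one_pos hl
  have p2 := truncExp_two_pos hl
  have p3 := truncExp_two_pos (by linarith : 0 < 2 * l)
  have hpos : 0 < corePoint n m l := by rw [e1]; positivity
  have q2 : 0 < 1 - corePoint n m l := by rw [e2]; positivity
  have q4 : 0 < (m : ℝ) / n - corePoint n m l := by rw [e4]; positivity
  refine ⟨hpos, by linarith, by linarith, ?_⟩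
  have : 0 < (3 * ((m : ℝ) / n) - corePoint n m l) - 2 * (1 - corePoint n m l) := by
    rw [e3, e2]
    have : l * truncExp 1 l * (Real.exp l + 1) / truncExp 2 (2 * l)
        - 2 * ((Real.exp l + 1) * truncExp 2 l / truncExp 2 (2 * l))
        = (Real.exp l + 1) * (l * truncExp 1 l - 2 * truncExp 2 l) / truncExp 2 (2 * l) := by
      field_simp
    rw [this]
    -- A truncated Poisson mean exceeds `2`: the difference is `∑ k l^(k+2) / (k+2)!`, whose term at
    -- `k = 1` is positive.
    have : 0 < l * truncExp 1 l - 2 * truncExp 2 l := by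
      have hs := (hasSum_mul_truncExp_one l).sub ((hasSum_truncExp_two l).mul_left 2)
      refine lt_of_lt_of_le ?_ (le_hasSum hs 1 fun k _ => ?_)
      · have : (0 : ℝ) < l ^ (1 + 2) / ((1 + 2)! : ℝ) := by positivity
        push_cast
        linarith
      · have : (0 : ℝ) ≤ k * (l ^ (k + 2) / ((k + 2)! : ℝ)) := by positivity
        show (0 : ℝ) ≤ _
        linarith
    positivity
  linarith

/-- The solution `l` of the core equation also solves the equation for `λ_x` at `x = n̂₁*`, so the
majorant with this `l` touches there. -/
lemma lambdaPart_corePoint (hl : 0 < l)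
    (h : l * truncExp 1 l * shiftExp 2 l / truncExp 2 (2 * l) = 3 * (m : ℝ) / n) :
    lambdaPart n m (corePoint n m l) = lambdaDual ((m : ℝ) / n) l (corePoint n m l) := by
  obtain ⟨b1, b2, b3, b4⟩ := corePoint_bounds hl h
  obtain ⟨e1, e2, e3, e4⟩ := corePoint_spec hl h
  refine lambdaPart_eq_lambdaDual b2 b4 hl ?_
  have p2 := truncExp_two_pos hl
  have p3 := truncExp_two_pos (by linarith : 0 < 2 * l)
  rw [e3, e2]
  generalize truncExp 2 (2 * l) = d at p3
  field_simp

/-- The `log n` terms cancel, and stationarity reads `3 l (1 - x)(c - x) = x (3c - x) f₂(l)`, which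
`corePoint_spec` verifies. -/
lemma hasDerivAt_majorant (hn : 1 ≤ n) (hl : 0 < l)
    (h : l * truncExp 1 l * shiftExp 2 l / truncExp 2 (2 * l) = 3 * (m : ℝ) / n) :
    HasDerivAt (fun x => coreEntropy n ((m : ℝ) / n) x + lambdaDual ((m : ℝ) / n) l x) 0
      (corePoint n m l) := by
  obtain ⟨b1, b2, b3, b4⟩ := corePoint_bounds hl h
  obtain ⟨e1, e2, e3, e4⟩ := corePoint_spec hl h
  set c := (m : ℝ) / n
  set x := corePoint n m l
  have p1 := truncExp_one_pos hl
  have p2 := truncExp_two_pos hl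
  have p3 := truncExp_two_pos (by linarith : 0 < 2 * l)
  have hx3 : 3 * c - x ≠ 0 := by linarith
  have d1 := (hasDerivAt_hCore hn hx3).comp_const_sub (3 * c) x
  have d2 := (hasDerivAt_hCore hn (by linarith : 1 - x ≠ 0)).comp_const_sub 1 x
  have d3 := hasDerivAt_hCore hn b1.ne'
  have d4 := (hasDerivAt_hCore hn (by linarith : c - x ≠ 0)).comp_const_sub c x
  have d5 := (hasDerivAt_id x).mul_const (Real.log 2)
  have d6 := ((hasDerivAt_id x).const_sub c).mul_const (Real.log 6)
  have d7 := ((hasDerivAt_id x).const_sub 1).mul_const (Real.log (truncExp 2 l))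
  have d8 := ((hasDerivAt_id x).const_sub (3 * c)).mul_const (Real.log l)
  convert! (((((d1.sub d2).sub d3).sub d4).sub d5).sub d6).add (d7.sub d8) using 1
  have l1 : Real.log (3 * c - x) = Real.log x + Real.log (Real.exp l + 1) := by
    rw [← Real.log_mul (by positivity) (by positivity), e3, e1]; congr 1; ring
  have l2 : Real.log (1 - x) =
      Real.log x + Real.log (Real.exp l + 1) + Real.log (truncExp 2 l) - Real.log l
        - Real.log (truncExp 1 l) := by
    have : Real.log (1 - x) + Real.log l + Real.log (truncExp 1 l) =
        Real.log x + Real.log (Real.exp l + 1) + Real.log (truncExp 2 l) := by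
      rw [← Real.log_mul (by linarith) (by positivity),
        ← Real.log_mul (mul_pos (by linarith) hl).ne' (by positivity),
        ← Real.log_mul (by positivity) (by positivity),
        ← Real.log_mul (by positivity) (by positivity), e2, e1]
      congr 1; ring
    linarith
  have l3 : Real.log (c - x) = Real.log x + Real.log (truncExp 1 l) - Real.log 3 := by
    rw [e4, Real.log_div (by positivity) (by norm_num), Real.log_mul (by positivity) (by positivity)]
  have l6 : Real.log 6 = Real.log 2 + Real.log 3 := by
    rw [← Real.log_mul (by norm_num) (by norm_num)]; norm_num
  rw [l1, l2, l3, l6]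
  ring

lemma fCore_le_corePoint (hn : 1 ≤ n) (hl : 0 < l)
    (h : l * truncExp 1 l * shiftExp 2 l / truncExp 2 (2 * l) = 3 * (m : ℝ) / n) {x : ℝ}
    (hx : x ∈ coreInterval n m \ {1}) : fCore n m x ≤ fCore n m (corePoint n m l) := by
  obtain ⟨b1, b2, b3, b4⟩ := corePoint_bounds hl h
  rw [mem_coreInterval_diff] at hx
  obtain ⟨⟨h0, h1⟩, h2, h3⟩ := hx
  rw [fCore_eq, fCore_eq, lambdaPart_corePoint hl h]
  refine (add_le_add_right (lambdaPart_le_lambdaDual h2 h1 hl) _).trans ?_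
  set c := (m : ℝ) / n with hc
  set y := corePoint n m l
  have hd := hasDerivAt_majorant hn hl h
  have hcc : ConcaveOn ℝ (Icc 0 (min 1 c)) (fun x => coreEntropy n c x + lambdaDual c l x) := by
    refine (strictConcaveOn_coreEntropy hn (by positivity)).concaveOn.add
      ⟨convex_Icc _ _, fun x _ y _ a b _ _ hab => le_of_eq ?_⟩
    simp only [lambdaDual, smul_eq_mul]
    obtain rfl : b = 1 - a := by linarith
    ring
  have hxm : x ∈ Icc 0 (min 1 c) := ⟨h0, le_min h2.le h3⟩
  have hym : y ∈ Icc 0 (min 1 c) := ⟨b1.le, le_min b2.le b3.le⟩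
  rcases lt_trichotomy x y with hxy | hxy | hxy
  · have := hcc.le_slope_of_hasDerivAt hxm hym hxy hd
    rw [slope_def_field, le_div_iff₀ (by linarith)] at this
    linarith
  · rw [hxy]
  · have := hcc.slope_le_of_hasDerivAt hym hxm hxy hd
    rw [slope_def_field, div_le_iff₀ (by linarith)] at this
    linarith

lemma corePoint_mem (hl : 0 < l)
    (h : l * truncExp 1 l * shiftExp 2 l / truncExp 2 (2 * l) = 3 * (m : ℝ) / n) :
    corePoint n m l ∈ coreInterval n m \ {1} := by
  obtain ⟨b1, b2, b3, b4⟩ := corePoint_bounds hl h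
  exact mem_coreInterval_diff.2 ⟨⟨b1.le, b4.le⟩, b2, b3.le⟩

lemma eq_corePoint_of_isMaxOn (hn : 1 ≤ n) (hl : 0 < l)
    (h : l * truncExp 1 l * shiftExp 2 l / truncExp 2 (2 * l) = 3 * (m : ℝ) / n) {x : ℝ}
    (hx : x ∈ coreInterval n m \ {1}) (hmax : fCore n m (corePoint n m l) ≤ fCore n m x) :
    x = corePoint n m l :=
  (strictConcaveOn_fCore hn).eq_of_isMaxOn
    (fun _ hy => (fCore_le_corePoint hn hl h hy).trans hmax)
    (fun _ hy => fCore_le_corePoint hn hl h hy) hx (corePoint_mem hl h)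

/-- Two solutions yield two maximisers, which coincide; `corePoint` is injective in `l`. No
monotonicity of the left-hand side is needed. -/
lemma core_parameter_unique (hn : 1 ≤ n) (hm : n < 2 * m) {l' : ℝ} (hl : 0 < l) (hl' : 0 < l')
    (h : l * truncExp 1 l * shiftExp 2 l / truncExp 2 (2 * l) = 3 * (m : ℝ) / n)
    (h' : l' * truncExp 1 l' * shiftExp 2 l' / truncExp 2 (2 * l') = 3 * (m : ℝ) / n) :
    l' = l := by
  have e := eq_corePoint_of_isMaxOn hn hl h (corePoint_mem hl' h')
    (fCore_le_corePoint hn hl' h' (corePoint_mem hl h))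
  have hc := one_half_lt_div hn hm
  rw [corePoint_eq, corePoint_eq, div_eq_div_iff (by positivity) (by positivity)] at e
  have e' := mul_left_cancel₀ (by linarith) e
  exact Real.exp_injective (by linarith)

end CorePoint

/-! ### Words in which every letter occurs at least twice. -/

section Words

open Classical in
/-- The words indexed by `T` over the alphabet `B` in which every letter occurs at least twice. -/
noncomputable def wideWords (T B : Type) [Fintype T] [Fintype B] : Finset (T → B) :=
  Finset.univ.filter fun w => ∀ b, 2 ≤ (Finset.univ.filter fun t => w t = b).card

open Classical in
lemma mem_wideWords {T B : Type} [Fintype T] [Fintype B] {w : T → B} :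
    w ∈ wideWords T B ↔ ∀ b, 2 ≤ (Finset.univ.filter fun t => w t = b).card := by
  simp [wideWords]

open Classical in
lemma card_wideWords_congr {T B C : Type} [Fintype T] [Fintype B] [Fintype C] (e : B ≃ C) :
    (wideWords T C).card ≤ (wideWords T B).card := by
  refine Finset.card_le_card_of_injOn (fun w t => e.symm (w t)) (fun w hw => ?_)
    (fun w _ w' _ h => ?_)
  · simp only [Finset.mem_coe, mem_wideWords] at hw ⊢
    intro b
    simpa [Equiv.symm_apply_eq] using hw (e b)
  · funext t
    exact e.symm.injective (congrFun h t)

open Classical in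
-- Once the positions `K` of the letter `none` are fixed, the word is determined by its restriction
-- to the complement, again a wide word.
lemma card_wideWords_fiber_le {T B : Type} [Fintype T] [Fintype B] (K : Finset T) :
    ((wideWords T (Option B)).filter
      fun w => (Finset.univ.filter fun t => w t = none) = K).card ≤
      if 2 ≤ K.card then (wideWords {t // t ∉ K} B).card else 0 := by
  split_ifs with hK
  · refine Finset.card_le_card_of_surjOn
      (fun (v : {t // t ∉ K} → B) t => if h : t ∈ K then none else some (v ⟨t, h⟩)) ?_
    intro w hw
    simp only [Finset.coe_filter, mem_ofPred_eq, mem_wideWords] at hw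
    obtain ⟨hw, rfl⟩ := hw
    have hs : ∀ t : {t // t ∉ Finset.univ.filter fun t => w t = none}, (w t).isSome := by
      rintro ⟨t, ht⟩
      simpa [Option.isSome_iff_ne_none] using ht
    refine ⟨fun t => (w t).get (hs t), ?_, ?_⟩
    · rw [Finset.mem_coe, mem_wideWords]
      intro b
      refine (hw (some b)).trans (Finset.card_le_card_of_surjOn Subtype.val ?_)
      intro t ht
      have ht' : w t = some b := by simpa using ht
      refine ⟨⟨t, by simp [ht']⟩, ?_, rfl⟩
      simp [ht']
    · funext t
      by_cases ht : w t = none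
      · simp [ht]
      · simp [ht]
  · rw [Nat.le_zero, Finset.card_eq_zero, Finset.filter_eq_empty_iff]
    rintro w hw rfl
    exact hK (by convert! mem_wideWords.1 hw none)

lemma sum_range_le_truncExp_two {l : ℝ} (hl : 0 < l) (t : ℕ) :
    ∑ k ∈ Finset.range (t + 1), (if 2 ≤ k then l ^ k / (k ! : ℝ) else 0) ≤ truncExp 2 l := by
  have h : HasSum (fun k : ℕ => if 2 ≤ k then l ^ k / (k ! : ℝ) else 0) (truncExp 2 l) := by
    rw [← hasSum_nat_add_iff' 2]
    convert! hasSum_truncExp_two l using 1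
    simp [Finset.sum_range_succ]
  exact sum_le_hasSum _ (fun k _ => by split_ifs <;> positivity) h

open Classical in
/-- The number of words in which every letter occurs at least twice is `|T|!` times the
coefficient of `z ^ |T|` in `f₂(z) ^ |B|`. -/
lemma card_wideWords_mul_le (B : Type) [Fintype B] {l : ℝ} (hl : 0 < l) :
    ∀ (T : Type) [Fintype T], ((wideWords T B).card : ℝ) * l ^ Fintype.card T ≤
      ((Fintype.card T)! : ℝ) * truncExp 2 l ^ Fintype.card B := by
  -- Induction on the alphabet, for all position sets at once because deleting a letter shrinks
  -- them. Since `choose t k * (t-k)! = t! / k!`, a new letter contributes a factor of at most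
  -- `f₂(l)`.
  refine Fintype.induction_empty_option (P := fun B _ => ∀ (T : Type) [Fintype T],
    ((wideWords T B).card : ℝ) * l ^ Fintype.card T ≤
      ((Fintype.card T)! : ℝ) * truncExp 2 l ^ Fintype.card B) ?_ ?_ ?_ B
  · intro A C _ e ih T _
    let _ := Fintype.ofEquiv _ e.symm
    rw [← Fintype.card_congr e]
    refine le_trans ?_ (ih T)
    gcongr
    exact card_wideWords_congr e
  · intro T _
    rcases isEmpty_or_nonempty T with hT | ⟨⟨t⟩⟩
    · have : (wideWords T PEmpty).card ≤ 1 := by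
        refine (Finset.card_le_univ _).trans ?_
        simp
      have h2 : ((wideWords T PEmpty).card : ℝ) ≤ 1 := by exact_mod_cast this
      simpa using h2
    · have : wideWords T PEmpty = ∅ := Finset.eq_empty_of_forall_notMem fun w => (w t).elim
      rw [this]
      simp
  · intro B _ ih T _
    set b := Fintype.card B
    set t := Fintype.card T with ht
    have hf := truncExp_two_pos hl
    have hcard := Finset.card_eq_sum_card_fiberwise (s := wideWords T (Option B))
      (t := (Finset.univ : Finset T).powerset)
      (f := fun w => Finset.univ.filter fun t => w t = none) (fun w _ => by simp)
    have h1 : ((wideWords T (Option B)).card : ℝ) * l ^ t ≤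
        ∑ K ∈ (Finset.univ : Finset T).powerset,
          (if 2 ≤ K.card then l ^ K.card * ((t - K.card)! * truncExp 2 l ^ b) else 0) := by
      rw [hcard, Nat.cast_sum, Finset.sum_mul]
      refine Finset.sum_le_sum fun K _ => ?_
      have hK := card_wideWords_fiber_le (B := B) K
      have hKt : K.card ≤ t := Finset.card_le_univ K
      split_ifs at hK ⊢ with h2
      · have h3 := ih {t // t ∉ K}
        have h4 : Fintype.card {t // t ∉ K} = t - K.card := by
          rw [Fintype.card_subtype_compl, Fintype.card_coe]
        rw [h4] at h3
        have h5 : l ^ t = l ^ K.card * l ^ (t - K.card) := by rw [← pow_add]; congr 1; omega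
        rw [h5, mul_left_comm]
        refine mul_le_mul_of_nonneg_left (le_trans ?_ h3) (by positivity)
        gcongr
      · rw [Nat.le_zero.1 hK]; simp
    refine h1.trans ?_
    have h2 := Finset.sum_powerset_apply_card (x := (Finset.univ : Finset T))
      (fun k => (if 2 ≤ k then l ^ k * (((t - k)! : ℝ) * truncExp 2 l ^ b) else 0))
    rw [h2, Finset.card_univ, ← ht, Fintype.card_option, pow_succ]
    have h3 : ∀ k ∈ Finset.range (t + 1),
        t.choose k • (if 2 ≤ k then l ^ k * (((t - k)! : ℝ) * truncExp 2 l ^ b) else 0) =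
        ((t ! : ℝ) * truncExp 2 l ^ b) * (if 2 ≤ k then l ^ k / (k ! : ℝ) else 0) := by
      intro k hk
      have hkt : k ≤ t := by simpa [Nat.lt_succ_iff] using hk
      split_ifs
      · rw [← Nat.choose_mul_factorial_mul_factorial hkt]
        push_cast
        rw [nsmul_eq_mul]
        field_simp
      · simp
    rw [Finset.sum_congr rfl h3, ← Finset.mul_sum, ← mul_assoc]
    exact mul_le_mul_of_nonneg_left (sum_range_le_truncExp_two hl t) (by positivity)

end Words

/-! ### Encoding cores by words. -/

section Cores

variable {V : Type}

/-- The positions of the vertices of degree at least `2` in the edges of a core, when `A` is the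
set of vertices of degree `1` and there are `k` edges disjoint from `A`. -/
abbrev CoreSlots (A : Finset V) (k : ℕ) : Type := ({a // a ∈ A} × Fin 2) ⊕ (Fin k × Fin 3)

lemma card_coreSlots (A : Finset V) (k : ℕ) :
    Fintype.card (CoreSlots A k) = 2 * A.card + 3 * k := by
  simp [CoreSlots]; ring

/-- The reorderings of the slots of a word that do not change its edge set. -/
abbrev SlotPerm (A : Finset V) (k : ℕ) : Type :=
  ({a // a ∈ A} → Equiv.Perm (Fin 2)) × Equiv.Perm (Fin k) × (Fin k → Equiv.Perm (Fin 3))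

/-- The action of the reorderings on the words. -/
def permWord {A : Finset V} {k : ℕ} (g : SlotPerm A k) (w : CoreSlots A k → {v // v ∉ A}) :
    CoreSlots A k → {v // v ∉ A} :=
  Sum.elim (fun p => w (Sum.inl (p.1, g.1 p.1 p.2)))
    (fun p => w (Sum.inr (g.2.1 p.1, g.2.2 p.1 p.2)))

lemma image_univ_comp_perm {ι α : Type*} [Fintype ι] [DecidableEq α] (σ : Equiv.Perm ι)
    (f : ι → α) : (Finset.univ.image fun i => f (σ i)) = Finset.univ.image f := by
  ext x
  simp only [Finset.mem_image, Finset.mem_univ, true_and]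
  exact ⟨fun ⟨i, h⟩ => ⟨σ i, h⟩, fun ⟨i, h⟩ => ⟨σ.symm i, by simpa using h⟩⟩

variable [DecidableEq V]

/-- The edge at the vertex `a` of degree `1`, read off from a word. -/
def pendantEdge {A : Finset V} {k : ℕ} (w : CoreSlots A k → {v // v ∉ A}) (a : {a // a ∈ A}) :
    Finset V :=
  insert (a : V) (Finset.univ.image fun i => (w (Sum.inl (a, i)) : V))

/-- The edge with number `j` among those disjoint from `A`, read off from a word. -/
def innerEdge {A : Finset V} {k : ℕ} (w : CoreSlots A k → {v // v ∉ A}) (j : Fin k) :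
    Finset V :=
  Finset.univ.image fun i => (w (Sum.inr (j, i)) : V)

lemma innerEdge_permWord {A : Finset V} {k : ℕ} (g : SlotPerm A k)
    (w : CoreSlots A k → {v // v ∉ A}) (j : Fin k) :
    innerEdge (permWord g w) j = innerEdge w (g.2.1 j) :=
  image_univ_comp_perm (g.2.2 j) fun i => (w (Sum.inr (g.2.1 j, i)) : V)

/-- The edge set read off from a word. -/
def wordEdges {A : Finset V} {k : ℕ} (w : CoreSlots A k → {v // v ∉ A}) : Finset (Finset V) :=
  Finset.univ.image (pendantEdge w) ∪ Finset.univ.image (innerEdge w)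

lemma exists_enum {α : Type} [DecidableEq α] {P : α → Prop} {s : Finset α} {r : ℕ}
    (hs : s.card = r) (hP : ∀ x ∈ s, P x) :
    ∃ f : Fin r → {x // P x}, Function.Injective f ∧
      (Finset.univ.image fun i => (f i : α)) = s := by
  let e := (Finset.equivFinOfCardEq hs).symm
  refine ⟨fun i => ⟨e i, hP _ (e i).2⟩, fun i j h => ?_, ?_⟩
  · have h' : (e i : α) = e j := by simpa only [Subtype.mk.injEq] using h
    exact e.injective (Subtype.ext h')
  · ext x
    simp only [Finset.mem_image, Finset.mem_univ, true_and]
    exact ⟨fun ⟨i, h⟩ => h ▸ (e i).2, fun h => ⟨e.symm ⟨x, h⟩, by simp⟩⟩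

lemma wordEdges_permWord {A : Finset V} {k : ℕ} (g : SlotPerm A k)
    (w : CoreSlots A k → {v // v ∉ A}) : wordEdges (permWord g w) = wordEdges w := by
  have h1 : pendantEdge (permWord g w) = pendantEdge w := by
    funext a
    exact congrArg (insert (a : V))
      (image_univ_comp_perm (g.1 a) fun i => (w (Sum.inl (a, i)) : V))
  have h2 : Finset.univ.image (innerEdge (permWord g w)) = Finset.univ.image (innerEdge w) := by
    rw [funext (innerEdge_permWord g w)]
    exact image_univ_comp_perm g.2.1 (innerEdge w)
  rw [wordEdges, wordEdges, h1, h2]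

/-- The words whose slots hold distinct vertices edge by edge, and whose inner edges are
distinct. -/
structure IsProperWord {A : Finset V} {k : ℕ} (w : CoreSlots A k → {v // v ∉ A}) : Prop where
  pendant : ∀ a, Function.Injective fun i => w (Sum.inl (a, i))
  inner : ∀ j, Function.Injective fun i => w (Sum.inr (j, i))
  edge : Function.Injective (innerEdge w)

/-- Distinct inner edges determine the permutation of the edges; only then can the orders within an
edge be compared. -/
lemma IsProperWord.permWord_injective {A : Finset V} {k : ℕ} {w : CoreSlots A k → {v // v ∉ A}}
    (hw : IsProperWord w) : Function.Injective fun g : SlotPerm A k => permWord g w := by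
  intro g g' h
  have h1 : g.1 = g'.1 := by
    funext a
    ext1 i
    exact hw.pendant a (congrFun h (Sum.inl (a, i)))
  have h2 : g.2.1 = g'.2.1 := by
    ext1 j
    refine hw.edge ?_
    rw [← innerEdge_permWord g w j, ← innerEdge_permWord g' w j]
    exact congrArg (fun v => innerEdge v j) h
  have h3 : g.2.2 = g'.2.2 := by
    funext j
    ext1 i
    have := congrFun h (Sum.inr (j, i))
    simp only [permWord, Sum.elim_inr, h2] at this
    exact hw.inner _ this
  exact Prod.ext h1 (Prod.ext h2 h3)

variable [Fintype V]

open Classical in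
/-- The cores with `m` edges in which `A` is the set of vertices of degree `1`. -/
noncomputable def coreClass (A : Finset V) (m : ℕ) : Finset (Finset (Finset V)) :=
  Finset.univ.filter fun E => IsHyperCore E ∧ E.card = m ∧ ∀ v, hyperDegree E v = 1 ↔ v ∈ A

lemma mem_coreClass {A : Finset V} {m : ℕ} {E : Finset (Finset V)} :
    E ∈ coreClass A m ↔ IsHyperCore E ∧ E.card = m ∧ ∀ v, hyperDegree E v = 1 ↔ v ∈ A := by
  simp [coreClass]

/-- Sending a slot to its edge maps the slots holding `b` onto the edges through `b`, of which there
are at least two. -/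
lemma wordEdges_mem_wideWords {A : Finset V} {m k : ℕ} {w : CoreSlots A k → {v // v ∉ A}}
    (h : wordEdges w ∈ coreClass A m) : w ∈ wideWords (CoreSlots A k) {v // v ∉ A} := by
  rw [mem_coreClass] at h
  obtain ⟨h1, -, h2⟩ := h
  rw [mem_wideWords]
  rintro ⟨b, hb⟩
  have hd : 2 ≤ hyperDegree (wordEdges w) b := by
    have := h1.not_isolated b
    have : hyperDegree (wordEdges w) b ≠ 1 := fun h => hb ((h2 b).1 h)
    omega
  refine hd.trans (Finset.card_le_card_of_surjOn
    (Sum.elim (fun p => pendantEdge w p.1) (fun p => innerEdge w p.1)) ?_)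
  intro e he
  simp only [wordEdges, Finset.coe_filter, Finset.mem_union, Finset.mem_image, Finset.mem_univ,
    true_and, mem_ofPred_eq] at he
  obtain ⟨⟨a, rfl⟩ | ⟨j, rfl⟩, hbe⟩ := he
  · simp only [pendantEdge, Finset.mem_insert, Finset.mem_image, Finset.mem_univ, true_and] at hbe
    rcases hbe with rfl | ⟨i, hi⟩
    · exact absurd a.2 hb
    · exact ⟨Sum.inl (a, i), by simpa [Subtype.ext_iff] using hi, rfl⟩
  · simp only [innerEdge, Finset.mem_image, Finset.mem_univ, true_and] at hbe
    obtain ⟨i, hi⟩ := hbe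
    exact ⟨Sum.inr (j, i), by simpa [Subtype.ext_iff] using hi, rfl⟩

lemma exists_pendant {A : Finset V} {m : ℕ} {E : Finset (Finset V)} (hE : E ∈ coreClass A m)
    (a : {a // a ∈ A}) : ∃ e ∈ E, (a : V) ∈ e ∧ ∀ e' ∈ E, (a : V) ∈ e' → e' = e := by
  have h := ((mem_coreClass.1 hE).2.2 a).2 a.2
  obtain ⟨e, he⟩ := Finset.card_eq_one.1 h
  have hm : ∀ e', e' ∈ E ∧ (a : V) ∈ e' ↔ e' = e := fun e' => by
    simpa using Finset.ext_iff.1 he e'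
  exact ⟨e, ((hm e).2 rfl).1, ((hm e).2 rfl).2, fun e' h1 h2 => (hm e').1 ⟨h1, h2⟩⟩

/-- Two vertices of degree `1` in a triple would leave at most one of degree at least `2`. Hence
distinct vertices of `A` lie in distinct edges. -/
lemma mem_unique_of_mem_edge {A : Finset V} {m : ℕ} {E : Finset (Finset V)}
    (hE : E ∈ coreClass A m) {e : Finset V} (he : e ∈ E) {a b : V} (ha : a ∈ A) (hb : b ∈ A)
    (hae : a ∈ e) (hbe : b ∈ e) : a = b := by
  obtain ⟨h1, -, h2⟩ := mem_coreClass.1 hE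
  by_contra hab
  have h3 := h1.two_le e he
  have h4 := h1.uniform e he
  have h5 : (e.filter fun v => 2 ≤ hyperDegree E v) ⊆ (e.erase a).erase b := by
    intro v hv
    rw [Finset.mem_filter] at hv
    refine Finset.mem_erase.2 ⟨?_, Finset.mem_erase.2 ⟨?_, hv.1⟩⟩
    · rintro rfl; have := (h2 v).2 hb; omega
    · rintro rfl; have := (h2 v).2 ha; omega
  have h6 := Finset.card_le_card h5
  rw [Finset.card_erase_of_mem (Finset.mem_erase.2 ⟨Ne.symm hab, hbe⟩),
    Finset.card_erase_of_mem hae] at h6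
  omega

lemma card_le_and_exists_properWord {A : Finset V} {m : ℕ} {E : Finset (Finset V)}
    (hE : E ∈ coreClass A m) :
    A.card ≤ m ∧ ∀ k, m = A.card + k →
      ∃ w : CoreSlots A k → {v // v ∉ A}, wordEdges w = E ∧ IsProperWord w := by
  choose p hpE hap hpu using exists_pendant hE
  obtain ⟨h1, hcard, h2⟩ := mem_coreClass.1 hE
  have hpinj : Function.Injective p := fun a b hab =>
    Subtype.ext (mem_unique_of_mem_edge hE (hpE a) a.2 b.2 (hap a) (hab ▸ hap b))
  have himg : Finset.univ.image p ⊆ E := by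
    intro e he
    obtain ⟨a, -, rfl⟩ := Finset.mem_image.1 he
    exact hpE a
  have hci : (Finset.univ.image p).card = A.card := by
    rw [Finset.card_image_of_injective _ hpinj, Finset.card_univ, Fintype.card_coe]
  refine ⟨hci ▸ hcard ▸ Finset.card_le_card himg, fun k hk => ?_⟩
  have hrest : (E \ Finset.univ.image p).card = k := by
    rw [Finset.card_sdiff_of_subset himg, hci, hcard]; omega
  obtain ⟨q, hq, hqimg⟩ := exists_enum (P := fun e => e ∈ E \ Finset.univ.image p) hrest
    fun e he => he
  have hx : ∀ a : {a // a ∈ A}, ∃ f : Fin 2 → {v // v ∉ A}, Function.Injective f ∧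
      (Finset.univ.image fun i => (f i : V)) = (p a).erase a := by
    intro a
    refine exists_enum ?_ fun v hv hvA => ?_
    · rw [Finset.card_erase_of_mem (hap a), h1.uniform _ (hpE a)]
    · exact (Finset.mem_erase.1 hv).1
        (mem_unique_of_mem_edge hE (hpE a) hvA a.2 (Finset.mem_erase.1 hv).2 (hap a))
  have hy : ∀ j : Fin k, ∃ f : Fin 3 → {v // v ∉ A}, Function.Injective f ∧
      (Finset.univ.image fun i => (f i : V)) = q j := by
    intro j
    have hj := Finset.mem_sdiff.1 (q j).2
    refine exists_enum (h1.uniform _ hj.1) fun v hv hvA => hj.2 ?_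
    rw [hpu ⟨v, hvA⟩ _ hj.1 hv]
    exact Finset.mem_image_of_mem _ (Finset.mem_univ _)
  choose x hxi hxe using hx
  choose y hyi hye using hy
  have hpend : pendantEdge (k := k) (Sum.elim (fun s => x s.1 s.2) (fun s => y s.1 s.2)) = p := by
    funext a
    simp only [pendantEdge, Sum.elim_inl]
    rw [hxe, Finset.insert_erase (hap a)]
  have hinner : innerEdge (A := A) (Sum.elim (fun s => x s.1 s.2) (fun s => y s.1 s.2)) =
      fun j => (q j : Finset V) := by
    funext j
    simp only [innerEdge, Sum.elim_inr]
    exact hye j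
  refine ⟨Sum.elim (fun s => x s.1 s.2) (fun s => y s.1 s.2), ?_, hxi, hyi, ?_⟩
  · rw [wordEdges, hpend, hinner, hqimg, Finset.union_sdiff_of_subset himg]
  · rw [hinner]
    exact Subtype.val_injective.comp hq

/-- Choose a proper word for each core. Pairs of a core and a reordering then inject into the wide
words: the edge set recovers the core, and freeness the reordering. -/
lemma card_coreClass_mul_le (A : Finset V) (k : ℕ) :
    (coreClass A (A.card + k)).card * (2 ^ A.card * (k ! * 6 ^ k)) ≤
      (wideWords (CoreSlots A k) {v // v ∉ A}).card := by
  have hG : Fintype.card (SlotPerm A k) = 2 ^ A.card * (k ! * 6 ^ k) := by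
    have h3 : (3 : ℕ)! = 6 := rfl
    simp [SlotPerm, Fintype.card_perm, h3]
  rcases (coreClass A (A.card + k)).eq_empty_or_nonempty with h0 | ⟨E₀, hE₀⟩
  · simp [h0]
  have : Nonempty (CoreSlots A k → {v // v ∉ A}) :=
    ⟨((card_le_and_exists_properWord hE₀).2 k rfl).choose⟩
  choose! W hW hWp using fun E (hE : E ∈ coreClass A (A.card + k)) =>
    (card_le_and_exists_properWord hE).2 k rfl
  rw [← hG, ← Finset.card_univ, ← Finset.card_product]
  refine Finset.card_le_card_of_injOn (fun x => permWord x.2 (W x.1)) ?_ ?_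
  · rintro ⟨E, g⟩ hx
    have hE := (Finset.mem_product.1 (Finset.mem_coe.1 hx)).1
    refine wordEdges_mem_wideWords (m := A.card + k) ?_
    rw [wordEdges_permWord, hW E hE]
    exact hE
  · rintro ⟨E, g⟩ hx ⟨E', g'⟩ hx' h
    have hE := (Finset.mem_product.1 (Finset.mem_coe.1 hx)).1
    have hE' := (Finset.mem_product.1 (Finset.mem_coe.1 hx')).1
    have h1 := congrArg wordEdges h
    simp only [wordEdges_permWord] at h1
    rw [hW E hE, hW E' hE'] at h1
    subst h1
    exact congrArg (Prod.mk E) ((hWp E hE).permWord_injective h)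

lemma card_coreClass_le (A : Finset V) (k : ℕ) {l : ℝ} (hl : 0 < l) :
    ((coreClass A (A.card + k)).card : ℝ) * (2 ^ A.card * (k ! * 6 ^ k))
        * l ^ (2 * A.card + 3 * k) ≤
      ((2 * A.card + 3 * k)! : ℝ) * truncExp 2 l ^ (Fintype.card V - A.card) := by
  have h1 := card_wideWords_mul_le {v // v ∉ A} hl (CoreSlots A k)
  have h2 : Fintype.card {v // v ∉ A} = Fintype.card V - A.card := by
    rw [Fintype.card_subtype_compl, Fintype.card_coe]
  rw [card_coreSlots, h2] at h1
  refine le_trans ?_ h1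
  gcongr
  exact_mod_cast card_coreClass_mul_le A k

/-- These inequalities place `|A| / n` in the domain of the core function. The last counts slots:
`2(|V| - |A|) ≤ 2|A| + 3k`. -/
lemma bounds_of_mem_coreClass {A : Finset V} {m : ℕ} {E : Finset (Finset V)}
    (hE : E ∈ coreClass A m) (hm : 0 < m) :
    A.card ≤ m ∧ A.card < Fintype.card V ∧ 2 * Fintype.card V ≤ 3 * m + A.card := by
  obtain ⟨h1, h2⟩ := card_le_and_exists_properWord hE
  obtain ⟨k, rfl⟩ := Nat.exists_eq_add_of_le h1
  obtain ⟨w, rfl, -⟩ := h2 k rfl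
  have hw := mem_wideWords.1 (wordEdges_mem_wideWords hE)
  have hcard : Fintype.card {v // v ∉ A} = Fintype.card V - A.card := by
    rw [Fintype.card_subtype_compl, Fintype.card_coe]
  have hAV := Finset.card_le_univ A
  refine ⟨h1, ?_, ?_⟩
  · by_contra hlt
    have h0 : IsEmpty {v // v ∉ A} := by
      rw [← Fintype.card_eq_zero_iff]; omega
    have : IsEmpty (CoreSlots A k) := Function.isEmpty w
    have := Fintype.card_eq_zero_iff.2 this
    rw [card_coreSlots] at this
    omega
  · classical
    have h3 := Finset.card_eq_sum_card_fiberwise (s := (Finset.univ : Finset (CoreSlots A k)))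
      (t := Finset.univ) (f := w) (fun _ _ => by simp)
    have h4 := Finset.card_nsmul_le_sum (Finset.univ : Finset {v // v ∉ A})
      (fun b => (Finset.univ.filter fun t => w t = b).card) 2 (fun b _ => by convert! hw b)
    rw [← h3, Finset.card_univ, Finset.card_univ, card_coreSlots, hcard, smul_eq_mul] at h4
    omega

end Cores

/-! ### Stirling estimates and the final count. -/

lemma mul_log_sub_le_log_factorial (k : ℕ) :
    (k : ℝ) * Real.log k - k ≤ Real.log (k ! : ℝ) := by
  rcases Nat.eq_zero_or_pos k with rfl | hk
  · simp
  · have h := Stirling.le_log_factorial_stirling hk.ne'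
    have h1 : 0 ≤ Real.log k := Real.log_natCast_nonneg k
    have h2 : 0 ≤ Real.log (2 * Real.pi) := Real.log_nonneg (by linarith [Real.pi_gt_three])
    linarith

/-- The Stirling sequence decreases from its first value `e / √2`, which yields the additive
constant `1`. -/
lemma log_factorial_le {k : ℕ} (hk : 1 ≤ k) :
    Real.log (k ! : ℝ) ≤ (k : ℝ) * Real.log k - k + 1 + Real.log k / 2 := by
  obtain ⟨j, rfl⟩ := Nat.exists_eq_add_of_le' hk
  have h := Stirling.log_stirlingSeq'_antitone (Nat.zero_le j)
  simp only [Function.comp_apply, Nat.succ_eq_add_one, zero_add] at h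
  rw [Stirling.stirlingSeq_one, Stirling.log_stirlingSeq_formula,
    Real.log_div (Real.exp_pos _).ne' (by positivity), Real.log_exp, Real.log_sqrt (by norm_num),
    Real.log_mul (by norm_num) (by positivity), Real.log_div (by positivity) (Real.exp_pos _).ne',
    Real.log_exp] at h
  linarith

lemma mul_hCore_div {n : ℕ} {y k : ℝ} (h : n * y = k) :
    n * hCore n y = k * Real.log k - k := by
  rw [hCore, mul_sub, ← mul_assoc, h, mul_comm y, h]

/-- The core function at the scaled number `a` of vertices of degree `1`. -/
lemma mul_fCore_div {n a k : ℕ} (hn : 1 ≤ n) (ha : a ≤ n) :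
    n * fCore n (a + k) ((a : ℝ) / n) =
      (((2 * a + 3 * k : ℕ) : ℝ) * Real.log (2 * a + 3 * k : ℕ) - (2 * a + 3 * k : ℕ))
      - (((n - a : ℕ) : ℝ) * Real.log (n - a : ℕ) - (n - a : ℕ))
      - ((a : ℝ) * Real.log a - a) - ((k : ℝ) * Real.log k - k)
      - a * Real.log 2 - k * Real.log 6 + n * lambdaPart n (a + k) ((a : ℝ) / n) := by
  have hn' : (n : ℝ) ≠ 0 := by positivity
  have e1 := mul_hCore_div (n := n) (y := 3 * (((a + k : ℕ) : ℝ) / n) - (a : ℝ) / n)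
    (k := (2 * a + 3 * k : ℕ)) (by push_cast; field_simp; ring)
  have e2 := mul_hCore_div (n := n) (y := 1 - (a : ℝ) / n) (k := (n - a : ℕ))
    (by rw [Nat.cast_sub ha]; field_simp)
  have e3 := mul_hCore_div (n := n) (y := (a : ℝ) / n) (k := a) (by field_simp)
  have e4 := mul_hCore_div (n := n) (y := ((a + k : ℕ) : ℝ) / n - (a : ℝ) / n) (k := k)
    (by push_cast; field_simp; ring)
  have e5 : (n : ℝ) * ((a : ℝ) / n * Real.log 2) = a * Real.log 2 := by field_simp
  have e6 : (n : ℝ) * ((((a + k : ℕ) : ℝ) / n - (a : ℝ) / n) * Real.log 6) = k * Real.log 6 := by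
    push_cast; field_simp; ring
  rw [fCore]
  linear_combination e1 - e2 - e3 - e4 - e5 - e6

lemma mul_lambdaDual_div {n a k : ℕ} (hn : 1 ≤ n) (ha : a ≤ n) (l : ℝ) :
    n * lambdaDual (((a + k : ℕ) : ℝ) / n) l ((a : ℝ) / n) =
      (n - a : ℕ) * Real.log (truncExp 2 l) - (2 * a + 3 * k : ℕ) * Real.log l := by
  have hn' : (n : ℝ) ≠ 0 := by positivity
  rw [lambdaDual, Nat.cast_sub ha]
  push_cast
  field_simp
  ring

lemma div_mem_coreInterval {n m a : ℕ} (hn : 1 ≤ n) (h1 : a ≤ m) (h2 : a < n)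
    (h3 : 2 * n ≤ 3 * m + a) : (a : ℝ) / n ∈ coreInterval n m \ {1} := by
  have hn' : (0 : ℝ) < n := by positivity
  refine mem_coreInterval_diff.2 ⟨⟨by positivity, ?_⟩, ?_, ?_⟩
  · rw [sub_le_iff_le_add, ← mul_div_assoc, ← add_div, le_div_iff₀ hn']
    have : (2 * n : ℝ) ≤ 3 * m + a := by exact_mod_cast h3
    linarith
  · rw [div_lt_one hn']; exact_mod_cast h2
  · gcongr

/-- Bound for the number of cores in which the vertices of degree `1` form the set `A`. -/
lemma card_coreClass_le_fCore {n m : ℕ} (hn : 1 ≤ n) (hm : n < 2 * m) {b : ℝ}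
    (hb : ∀ x ∈ coreInterval n m \ {1}, fCore n m x ≤ b) (A : Finset (Fin n)) :
    ((coreClass A m).card : ℝ) ≤
      Real.exp 1 * Real.sqrt (3 * m) * Real.exp (n * b) * ((A.card ! : ℝ) * ((n - A.card)! : ℝ)) := by
  rcases (coreClass A m).eq_empty_or_nonempty with h0 | ⟨E, hE⟩
  · rw [h0, Finset.card_empty, Nat.cast_zero]; positivity
  obtain ⟨h1, h2, h3⟩ := bounds_of_mem_coreClass hE (by omega)
  rw [Fintype.card_fin] at h2 h3
  have hcard : (0 : ℝ) < (coreClass A m).card := by exact_mod_cast Finset.card_pos.2 ⟨E, hE⟩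
  have hx := div_mem_coreInterval hn h1 h2 h3
  have hbx := hb _ hx
  rw [mem_coreInterval_diff] at hx
  set a := A.card with ha
  obtain ⟨k, rfl⟩ := Nat.exists_eq_add_of_le h1
  have hn0 : (0 : ℝ) < n := by positivity
  have hm0 : (0 : ℝ) < (a + k : ℕ) := by exact_mod_cast (by omega : 0 < a + k)
  set N := ((coreClass A (a + k)).card : ℝ)
  -- The counting bound for a nearly optimal `l`; the slack `ε / n` becomes `ε` after scaling by
  -- `n`.
  have key : Real.log N + a * Real.log 2 + Real.log (k ! : ℝ) + k * Real.log 6 ≤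
      Real.log ((2 * a + 3 * k)! : ℝ) + n * lambdaPart n (a + k) ((a : ℝ) / n) := by
    refine le_of_forall_pos_le_add fun ε hε => ?_
    obtain ⟨l, hl, h⟩ := exists_lambdaDual_le (n := n) (m := a + k) hx.2.1 hx.1.2
      (div_pos hε hn0)
    have h4 := card_coreClass_le A k hl
    rw [Fintype.card_fin, ← ha] at h4
    have h5 := Real.log_le_log (by positivity) h4
    have hf := truncExp_two_pos hl
    rw [Real.log_mul (by positivity) (by positivity), Real.log_mul (by positivity) (by positivity),
      Real.log_mul (by positivity) (by positivity), Real.log_mul (by positivity) (by positivity),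
      Real.log_mul (by positivity) (by positivity), Real.log_pow, Real.log_pow, Real.log_pow,
      Real.log_pow] at h5
    have h6 := mul_le_mul_of_nonneg_left h hn0.le
    rw [mul_lambdaDual_div hn h2.le, mul_add, mul_div_cancel₀ _ hn0.ne'] at h6
    linarith
  -- Only `Q!` needs an upper bound, which costs `e √Q ≤ e √(3m)`; the other three factorials are
  -- bounded below without error terms.
  have hQ := log_factorial_le (k := 2 * a + 3 * k) (by omega)
  have hk := mul_log_sub_le_log_factorial k
  have ha' := mul_log_sub_le_log_factorial a
  have hna := mul_log_sub_le_log_factorial (n - a)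
  have hf := mul_fCore_div (k := k) hn h2.le
  have hfb := mul_le_mul_of_nonneg_left hbx hn0.le
  have hQm : Real.log (2 * a + 3 * k : ℕ) ≤ Real.log (3 * (a + k : ℕ)) := by
    refine Real.log_le_log (by exact_mod_cast (by omega : 0 < 2 * a + 3 * k)) ?_
    exact_mod_cast (by omega : 2 * a + 3 * k ≤ 3 * (a + k))
  have hsq : 0 < Real.sqrt (3 * (a + k : ℕ)) := Real.sqrt_pos.2 (by positivity)
  rw [← Real.log_le_log_iff hcard (by positivity), Real.log_mul (by positivity) (by positivity),
    Real.log_mul (by positivity) (by positivity), Real.log_mul (by positivity) (by positivity),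
    Real.log_mul (by positivity) (by positivity), Real.log_exp, Real.log_exp,
    Real.log_sqrt (by positivity)]
  linarith

lemma numCores_le_sum (n m : ℕ) :
    numCores n m ≤ ∑ A ∈ (Finset.univ : Finset (Fin n)).powerset, (coreClass A m).card := by
  classical
  have h : {E : Finset (Finset (Fin n)) | IsHyperCore E ∧ E.card = m} ⊆
      ((Finset.univ : Finset (Fin n)).powerset.biUnion fun A => coreClass A m :
        Finset (Finset (Finset (Fin n)))) := by
    rintro E ⟨h1, h2⟩
    rw [Finset.mem_coe, Finset.mem_biUnion]
    exact ⟨Finset.univ.filter fun v => hyperDegree E v = 1, by simp,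
      mem_coreClass.2 ⟨h1, h2, fun v => by simp⟩⟩
  have h' := ncard_le_ncard h
  rw [ncard_coe_finset] at h'
  exact h'.trans Finset.card_biUnion_le

lemma numCores_le {n m : ℕ} (hn : 1 ≤ n) (hm : n < 2 * m) {b : ℝ}
    (hb : ∀ x ∈ coreInterval n m \ {1}, fCore n m x ≤ b) :
    (numCores n m : ℝ) ≤
      2 * Real.exp 1 * Real.sqrt 3 * n * Real.sqrt m * (n ! : ℝ) * Real.exp (n * b) := by
  set K := Real.exp 1 * Real.sqrt (3 * m) * Real.exp (n * b) with hK
  -- Each of the `n + 1` possible sizes of `A` contributes exactly `n!`.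
  have hsum : ∑ A ∈ (Finset.univ : Finset (Fin n)).powerset,
      ((A.card ! : ℝ) * ((n - A.card)! : ℝ)) = (n + 1) * (n ! : ℝ) := by
    have h := Finset.sum_powerset_apply_card (x := (Finset.univ : Finset (Fin n)))
      (fun a => ((a ! : ℝ) * ((n - a)! : ℝ)))
    rw [h, Finset.card_univ, Fintype.card_fin, Finset.sum_congr rfl (g := fun _ => (n ! : ℝ))]
    · simp
    · intro a ha
      have ha' : a ≤ n := by simpa [Nat.lt_succ_iff] using ha
      rw [← Nat.choose_mul_factorial_mul_factorial ha']
      push_cast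
      rw [nsmul_eq_mul, mul_assoc]
  calc (numCores n m : ℝ)
      ≤ ∑ A ∈ (Finset.univ : Finset (Fin n)).powerset, ((coreClass A m).card : ℝ) := by
        exact_mod_cast numCores_le_sum n m
    _ ≤ ∑ A ∈ (Finset.univ : Finset (Fin n)).powerset,
          K * ((A.card ! : ℝ) * ((n - A.card)! : ℝ)) :=
        Finset.sum_le_sum fun A _ => card_coreClass_le_fCore hn hm hb A
    _ = K * ((n + 1) * (n ! : ℝ)) := by rw [← Finset.mul_sum, hsum]
    _ ≤ K * ((2 * n) * (n ! : ℝ)) := by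
        have : (1 : ℝ) ≤ n := by exact_mod_cast hn
        have hK0 : 0 ≤ K := by positivity
        gcongr
        linarith
    _ = _ := by rw [hK, Real.sqrt_mul (by norm_num)]; ring

theorem mainTheorem3 :
    ∃ α : ℝ, 0 < α ∧ ∀ n m : ℕ, 1 ≤ n → n < 2 * m →
      ∃ l : ℝ,
        -- `l` is the unique positive solution of `l f₁(l) g₂(l) / f₂(2l) = 3m/n`
        (0 < l ∧ l * truncExp 1 l * shiftExp 2 l / truncExp 2 (2 * l) = 3 * (m : ℝ) / n) ∧
        (∀ l' : ℝ, 0 < l' →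
          l' * truncExp 1 l' * shiftExp 2 l' / truncExp 2 (2 * l') = 3 * (m : ℝ) / n → l' = l) ∧
        -- the bound on the number of cores
        (numCores n m : ℝ) ≤
          α * n * Real.sqrt m * (n ! : ℝ) * Real.exp (n * fCore n m (corePoint n m l)) ∧
        -- the core function is continuous and strictly concave, with limit `-∞` at the point `1`
        -- if that point belongs to the interval
        ContinuousOn (fCore n m) (coreInterval n m \ {1}) ∧
        (1 ∈ coreInterval n m → Tendsto (fCore n m) (𝓝[<] 1) atBot) ∧
        StrictConcaveOn ℝ (coreInterval n m \ {1}) (fCore n m) ∧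
        -- `corePoint n m l` is its unique maximiser
        corePoint n m l ∈ coreInterval n m \ {1} ∧
        (∀ x ∈ coreInterval n m \ {1}, x ≠ corePoint n m l →
          fCore n m x < fCore n m (corePoint n m l)) := by
  refine ⟨2 * Real.exp 1 * Real.sqrt 3, by positivity, fun n m hn hm => ?_⟩
  have hc : 3 / 2 < 3 * (m : ℝ) / n := by
    have := one_half_lt_div hn hm
    rw [mul_div_assoc]
    linarith
  obtain ⟨l, hl, h⟩ := exists_core_parameter hc
  refine ⟨l, ⟨hl, h⟩, fun l' hl' h' => core_parameter_unique hn hm hl hl' h h',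
    numCores_le hn hm fun x hx => fCore_le_corePoint hn hl h hx, continuousOn_fCore hn hm,
    tendsto_fCore_atBot hn, strictConcaveOn_fCore hn, corePoint_mem hl h, fun x hx hne => ?_⟩
  by_contra! hle
  exact hne (eq_corePoint_of_isMaxOn hn hl h hx hle)
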